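/- Let $N\ge 2$ and let $$|\psi\rangle_{AB_1\cdots B_{N-1}}=a|10\cdots0\rangle+b_1|01\cdots0\rangle+\cdots+b_{N-1}|00\cdots1\rangle$$ be an $N$-qubit generalized $W$-class state, with $a,b_1,\dots,b_{N-1}\in\mathbb C$ and $|a|^2+\sum_{i=1}^{N-1}|b_i|^2=1$. Put $\rho=|\psi\rangle\langle\psi|$, write $\rho_{AB_i}$ and $\rho_{AB_{i+1}\cdots B_{N-1}}$ for the reduced states of $\rho$ on the indicated qubits, and write $\rho_{A|B_1\cdots B_{N-1}}$ for $\rho$ regarded as a bipartite state with respect to the cut between $A$ and $B_1\cdots B_{N-1}$. For a bipartite pure state $|\phi\rangle_{AB}$ with $\rho_A=\mathrm{tr}_B|\phi\rangle\langle\phi|$ let $C(|\phi\rangle)=\sqrt{2(1-\mathrm{tr}\,\rho_A^2)}$ be the concurrence and let $E_\alpha(|\phi\rangle)=\frac{1}{1-\alpha}\log_2(\mathrm{tr}\,\rho_A^\alpha)$ be the Rényi-$\alpha$ entanglement, which for $\alpha=1$ is understood as the von Neumann entropy $-\mathrm{tr}(\rho_A\log_2\rho_A)$. For a bipartite mixed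 state $\sigma_{AB}$ let $$C(\sigma_{AB})=\min\sum_k p_k\,C(|\phi_k\rangle),\qquad E^a_\alpha(\sigma_{AB})=\max\sum_k p_k\,E_\alpha(|\phi_k\rangle),$$ the minimum and the maximum being taken over all pure state decompositions $\sigma_{AB}=\sum_k p_k|\phi_k\rangle\langle\phi_k|$. Let $C_{AB_i}=C(\rho_{AB_i})$, and let $C_{A|B_{i+1}\cdots B_{N-1}}$ be the concurrence of $\rho_{AB_{i+1}\cdots B_{N-1}}$ with respect to the cut between $A$ and $B_{i+1}\cdots B_{N-1}$. If $C_{AB_i}\ge C_{A|B_{i+1}\cdots B_{N-1}}$ for all $i=1,\dots,N-2$, then $$\bigl[E^a_\alpha(\rho_{A|B_1\cdots B_{N-1}})\bigr]^\mu\le\sum_{i=1}^{N-1}(2^\mu-1)^{i-1}\bigl[E^a_\alpha(\rho_{AB_i})\bigr]^\mu$$ for all $0\le\mu\le1$ and all $\alpha\in\left[\frac{\sqrt7-1}{2},\frac{\sqrt{13}-1}{2}\right]$, with the convention $0^0=1$. -/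

import Mathlib

open scoped Matrix

namespace QInfo

noncomputable section

variable {a b d : Type*} [Fintype a] [Fintype b] [Fintype d]

/-- `ψ` is a unit vector of `ℂ^d`, written in the standard basis. -/
def IsUnitVector (ψ : d → ℂ) : Prop := ∑ x, ‖ψ x‖ ^ 2 = 1

/-- The rank-one operator `|ψ⟩⟨ψ|`. -/
def pureDensity (ψ : d → ℂ) : Matrix d d ℂ := Matrix.vecMulVec ψ (star ψ)

/-- The partial trace `Tr_B ρ` of an operator on `H_A ⊗ H_B`. -/
def partialTraceB (ρ : Matrix (a × b) (a × b) ℂ) : Matrix a a ℂ :=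
  fun i j => ∑ k, ρ (i, k) (j, k)

/-- The reduced density matrix `ρ_A = Tr_B |ψ⟩⟨ψ|` of a bipartite vector. -/
def reducedA (ψ : a × b → ℂ) : Matrix a a ℂ := partialTraceB (pureDensity ψ)

theorem reducedA_isHermitian {a b : Type*} [Fintype b] (ψ : a × b → ℂ) : (reducedA ψ).IsHermitian := by
  ext i j
  simp [reducedA, partialTraceB, pureDensity, Matrix.vecMulVec_apply, mul_comm]

/-- The Rényi-`α` entropy (base 2) of a density matrix, through its eigenvalues; at `α = 1` it is
the von Neumann entropy, the limit as `α → 1`. -/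
def renyiEntropy [DecidableEq a] (α : ℝ) (ρ : Matrix a a ℂ) (hρ : ρ.IsHermitian) : ℝ :=
  if α = 1 then -∑ i, hρ.eigenvalues i * Real.logb 2 (hρ.eigenvalues i)
  else 1 / (1 - α) * Real.logb 2 (∑ i, hρ.eigenvalues i ^ α)

/-- The Rényi-`α` entanglement of a bipartite pure state, `E_α(|ψ⟩_{A|B}) = S_α(ρ_A)`. -/
def renyiEntanglementPure [DecidableEq a] (α : ℝ) (ψ : a × b → ℂ) : ℝ :=
  renyiEntropy α (reducedA ψ) (reducedA_isHermitian ψ)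

/-- The concurrence of a bipartite pure state, `C(|ψ⟩_{A|B}) = √(2 (1 - tr ρ_A²))`. -/
def concurrencePure (ψ : a × b → ℂ) : ℝ :=
  √(2 * (1 - ((reducedA ψ * reducedA ψ).trace).re))

/-- A (finite) pure state decomposition `ρ = ∑ i, p i |ψ i⟩⟨ψ i|`. -/
structure PureDecomposition (ρ : Matrix d d ℂ) where
  /-- the number of terms -/
  n : ℕ
  /-- the probabilities -/
  p : Fin n → ℝ
  /-- the pure states -/
  ψ : Fin n → d → ℂ
  p_nonneg : ∀ i, 0 ≤ p i
  p_sum : ∑ i, p i = 1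
  unit : ∀ i, IsUnitVector (ψ i)
  decomp : ρ = ∑ i, (p i : ℂ) • pureDensity (ψ i)

/-- The average of a pure state quantity over a decomposition. -/
def PureDecomposition.average {ρ : Matrix d d ℂ} (D : PureDecomposition ρ) (F : (d → ℂ) → ℝ) : ℝ :=
  ∑ i, D.p i * F (D.ψ i)

/-- The concurrence of a bipartite mixed state with respect to the cut `A|B`: the convex roof,
i.e. the least average concurrence over all pure state decompositions. -/
def concurrence (ρ : Matrix (a × b) (a × b) ℂ) : ℝ :=
  ⨅ D : PureDecomposition ρ, D.average concurrencePure

/-- The Rényi-`α` entanglement of assistance with respect to the cut `A|B`: the greatest average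
Rényi-`α` entanglement over all pure state decompositions. For a density matrix the averages form
a nonempty bounded set, so the supremum is the genuine one. -/
def renyiAssistance [DecidableEq a] (α : ℝ) (ρ : Matrix (a × b) (a × b) ℂ) : ℝ :=
  ⨆ D : PureDecomposition ρ, D.average (renyiEntanglementPure α)

/-- Basis labels of a system that consists of a qubit `A` and one qubit `B_k` for each `k : κ`. -/
abbrev Qubits (κ : Type*) : Type _ := Fin 2 × (κ → Fin 2)

/-- The reduced state on `A` and the qubits `B_k`, `k ∈ S`: all `B_k` with `k ∉ S` are traced
out. -/
def marginal {κ : Type*} [Fintype κ] [DecidableEq κ] (ρ : Matrix (Qubits κ) (Qubits κ) ℂ)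
    (S : Finset κ) : Matrix (Qubits {k // k ∈ S}) (Qubits {k // k ∈ S}) ℂ :=
  fun x y => ∑ e : {k // k ∉ S} → Fin 2,
    ρ (x.1, (Equiv.piEquivPiSubtypeProd (· ∈ S) fun _ => Fin 2).symm (x.2, e))
      (y.1, (Equiv.piEquivPiSubtypeProd (· ∈ S) fun _ => Fin 2).symm (y.2, e))

/-- The computational basis vector `|x⟩`. -/
def ket [DecidableEq d] (x : d) : d → ℂ := Pi.single x 1

/-- The generalized W-class vector
`a|10⋯0⟩ + b_1|01⋯0⟩ + ⋯ + b_n|00⋯1⟩` of the qubits `A, B_1, …, B_n`. -/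
def wState {n : ℕ} (a : ℂ) (b : Fin n → ℂ) : Qubits (Fin n) → ℂ :=
  a • ket (1, 0) + ∑ i, b i • ket (0, Pi.single i 1)

end

end QInfo

/-! ### Monotonicity of a hyperbolic ratio. -/

namespace QInfo

open Real

/-! For a pure state of a qubit against any other system, `E_α` is a function f =
`renyiOfSqConcurrence α` of the squared concurrence. The analytic core is that f is increasing and
concave on [0,1] when α ≥ 1/2 and α² + α ≤ 3, a range containing the interval of the theorem. Since
f(0) = 0, f is subadditive.

For W-class states squared concurrences add up: with c_i = 4|a|²|b_i|² they are ∑ c_i across the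
full cut, c_i for AB_i, and ∑_{j>i} c_j for A against the later qubits. So the hypothesis says that
each c_i except the last dominates the sum of its successors. All decompositions of the pure ρ give
the average f(∑ c_i). Each ρ_{AB_i} has a decomposition into states of squared concurrence c_i, so
its assistance is at least f(c_i); the optimal value is not needed. What remains, f(∑ c_i)^μ ≤ ∑
(2^μ-1)^i f(c_i)^μ with i counted from 0, is `rpow_apply_sum_le`: split off c_0 by subadditivity,
apply (x+y)^μ ≤ x^μ + (2^μ-1)y^μ for y ≤ x, and iterate.

For concavity, f' must increase with y = √(1-x). Putting y = tanh t and β = α-1 ≠ 0 turns f' into a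
constant times a hyperbolic ratio (`sinh_ratio_monotoneOn`), whose derivative has the sign of a
combination of sinh's with nonnegative Taylor coefficients. The first coefficient that is not
identically zero is nonnegative exactly when α² + α ≤ 3. The case α = 1 uses a logarithmic series
instead. -/

theorem sinh_coeff_nonneg {β : ℝ} (hβ : -1 / 2 ≤ β) (h : β ^ 2 + 3 * β ≤ 1) (i : ℕ) :
    0 ≤ 2 * 3 ^ (2 * i + 1) - 3 * (1 + β) * (1 + 2 * β) ^ (2 * i + 1)
      + (1 - β) * (1 - 2 * β) ^ (2 * i + 1) := by
  have hβ3 : β ≤ 1 / 3 := by nlinarith [sq_nonneg β]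
  rcases i with _ | i
  -- At exponent 1 the expression is 4(1 - 3β - β²): this is where the upper bound on β is sharp.
  · norm_num
    nlinarith
  · have h1 : (1 + 2 * β) ^ (2 * i + 1) ≤ 3 ^ (2 * i + 1) :=
      pow_le_pow_left₀ (by linarith) (by linarith) _
    -- The target 18 is 2·3², left over from the leading term once 3^(2i+1) is split off.
    have h2 : 3 * (1 + β) * (1 + 2 * β) ^ 2 ≤ 18 := by
      nlinarith [mul_nonneg (by linarith : 0 ≤ 1 + β) (sq_nonneg (1 + 2 * β)),
        mul_nonneg (by linarith : 0 ≤ 1 / 3 - β) (by linarith : 0 ≤ 1 + 2 * β)]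
    have h3 : 0 ≤ (1 - β) * (1 - 2 * β) ^ (2 * (i + 1) + 1) :=
      mul_nonneg (by linarith) (pow_nonneg (by linarith) _)
    have h4 : 3 * (1 + β) * (1 + 2 * β) ^ 2 * (1 + 2 * β) ^ (2 * i + 1) ≤ 18 * 3 ^ (2 * i + 1) :=
      mul_le_mul h2 h1 (pow_nonneg (by linarith) _) (by norm_num)
    have e1 : (1 + 2 * β) ^ (2 * (i + 1) + 1) = (1 + 2 * β) ^ 2 * (1 + 2 * β) ^ (2 * i + 1) := by
      ring
    have e2 : (3 : ℝ) ^ (2 * (i + 1) + 1) = 9 * 3 ^ (2 * i + 1) := by ring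
    rw [e1, e2]
    linarith

/-- The coefficient vanishes at i = 0, and consecutive ones differ by 4β² times the quantity in
`sinh_coeff_nonneg`; the square makes the sign of β irrelevant. -/
theorem sinh_comb_coeff_nonneg {β : ℝ} (hβ : -1 / 2 ≤ β) (h : β ^ 2 + 3 * β ≤ 1) (i : ℕ) :
    0 ≤ β * (β * 3 ^ (2 * i + 1) + (4 + β) - 3 * (1 + 2 * β) ^ (2 * i + 1)
      - (1 - 2 * β) ^ (2 * i + 1)) := by
  induction i with
  | zero => norm_num; nlinarith
  | succ i ih =>
    have := mul_nonneg (mul_self_nonneg β) (sinh_coeff_nonneg hβ h i)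
    have e : ∀ x : ℝ, x ^ (2 * (i + 1) + 1) = x ^ 2 * x ^ (2 * i + 1) := fun x => by ring
    simp only [e]
    linear_combination ih + 4 * this

theorem sinh_comb_nonneg {β t : ℝ} (hβ : -1 / 2 ≤ β) (h : β ^ 2 + 3 * β ≤ 1) (ht : 0 ≤ t) :
    0 ≤ β * (β * sinh (3 * t) + (4 + β) * sinh t - 3 * sinh ((1 + 2 * β) * t)
      - sinh ((1 - 2 * β) * t)) := by
  have hs := (((((hasSum_sinh (3 * t)).mul_left β).add ((hasSum_sinh t).mul_left (4 + β))).sub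
    ((hasSum_sinh ((1 + 2 * β) * t)).mul_left 3)).sub (hasSum_sinh ((1 - 2 * β) * t))).mul_left β
  refine hs.nonneg fun i => ?_
  have := mul_nonneg (sinh_comb_coeff_nonneg hβ h i)
    (by positivity : 0 ≤ t ^ (2 * i + 1) / ((2 * i + 1).factorial : ℝ))
  simp only [mul_pow]
  linear_combination this

theorem sinh_ratio_monotoneOn {β : ℝ} (hβ : -1 / 2 ≤ β) (h : β ^ 2 + 3 * β ≤ 1) (h0 : β ≠ 0) :
    MonotoneOn (fun t => sinh (β * t) * cosh t ^ 2 / (β * (sinh t * cosh ((1 + β) * t))))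
      (Set.Ioi 0) := by
  have hd : ∀ t ∈ Set.Ioi (0 : ℝ), HasDerivAt
      (fun t => sinh (β * t) * cosh t ^ 2 / (β * (sinh t * cosh ((1 + β) * t))))
      (((cosh (β * t) * β * cosh t ^ 2 + sinh (β * t) * (2 * cosh t * sinh t))
          * (β * (sinh t * cosh ((1 + β) * t)))
        - sinh (β * t) * cosh t ^ 2 * (β * (cosh t * cosh ((1 + β) * t)
          + sinh t * (sinh ((1 + β) * t) * (1 + β)))))
        / (β * (sinh t * cosh ((1 + β) * t))) ^ 2) t := by
    intro t ht
    have hne : β * (sinh t * cosh ((1 + β) * t)) ≠ 0 :=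
      mul_ne_zero h0 (mul_ne_zero (sinh_pos_iff.2 ht).ne' (cosh_pos _).ne')
    have hb : HasDerivAt (fun t : ℝ => β * t) β t := by simpa using (hasDerivAt_id t).const_mul β
    have hb1 : HasDerivAt (fun t : ℝ => (1 + β) * t) (1 + β) t := by
      simpa using (hasDerivAt_id t).const_mul (1 + β)
    have h1 := hb.sinh.mul ((hasDerivAt_cosh t).pow 2)
    have h2 := ((hasDerivAt_sinh t).mul hb1.cosh).const_mul β
    refine HasDerivAt.congr_deriv (h1.div h2 hne) ?_
    simp
  refine monotoneOn_of_deriv_nonneg (convex_Ioi 0)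
    (fun t ht => (hd t ht).continuousAt.continuousWithinAt)
    (fun t ht => (hd t (interior_subset ht)).differentiableAt.differentiableWithinAt) ?_
  intro t ht
  rw [interior_Ioi] at ht
  rw [(hd t ht).deriv]
  refine div_nonneg ?_ (sq_nonneg _)
  have hM := mul_nonneg (sinh_comb_nonneg hβ h (le_of_lt ht)) (cosh_pos t).le
  have e3 : sinh (3 * t) = 4 * sinh t ^ 3 + 3 * sinh t := sinh_three_mul t
  have eb : sinh ((1 + β) * t) = sinh t * cosh (β * t) + cosh t * sinh (β * t) := by
    rw [← sinh_add]; ring_nf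
  have eb' : cosh ((1 + β) * t) = cosh t * cosh (β * t) + sinh t * sinh (β * t) := by
    rw [← cosh_add]; ring_nf
  have es : sinh (2 * (β * t)) = 2 * sinh (β * t) * cosh (β * t) := sinh_two_mul _
  have ec : cosh (2 * (β * t)) = cosh (β * t) ^ 2 + sinh (β * t) ^ 2 := cosh_two_mul _
  have e2 : sinh ((1 + 2 * β) * t) = sinh t * cosh (2 * (β * t)) + cosh t * sinh (2 * (β * t)) := by
    rw [← sinh_add]; ring_nf
  have e2' : sinh ((1 - 2 * β) * t) = sinh t * cosh (2 * (β * t)) - cosh t * sinh (2 * (β * t)) := by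
    rw [← sinh_sub]; ring_nf
  rw [e3, e2, e2', es, ec] at hM
  rw [eb, eb']
  have c1 := cosh_sq t
  have c2 := cosh_sq (β * t)
  generalize cosh t = c at *
  generalize sinh t = s at *
  generalize cosh (β * t) = C at *
  generalize sinh (β * t) = S at *
  clear e2 e2' eb eb' e3 es ec hd
  -- Modulo cosh² = 1 + sinh², the numerator of the quotient rule is cosh t / 4 times the
  -- combination in `sinh_comb_nonneg`.
  refine le_of_le_of_eq (div_nonneg hM (by norm_num : (0:ℝ) ≤ 4)) ?_
  grind

/-! ### Concavity and monotonicity in the squared concurrence. -/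

/-- The Rényi-`α` entropy (base 2) of the two-point distribution `(p, q)`. -/
noncomputable def binaryRenyi (α p q : ℝ) : ℝ :=
  if α = 1 then -(p * logb 2 p + q * logb 2 q) else 1 / (1 - α) * logb 2 (p ^ α + q ^ α)

theorem binaryRenyi_comm (α p q : ℝ) : binaryRenyi α p q = binaryRenyi α q p := by
  simp only [binaryRenyi, add_comm]

/-- The Rényi-`α` entanglement of a pure state of a qubit and another system, as a function of
its squared concurrence. -/
noncomputable def renyiOfSqConcurrence (α x : ℝ) : ℝ :=
  binaryRenyi α ((1 + √(1 - x)) / 2) ((1 - √(1 - x)) / 2)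

theorem sqrt_one_sub_mem_Ioo {x : ℝ} (hx : x ∈ Set.Ioo (0 : ℝ) 1) :
    √(1 - x) ∈ Set.Ioo (0 : ℝ) 1 := by
  refine ⟨sqrt_pos.2 (by linarith [hx.2]), ?_⟩
  rw [sqrt_lt' one_pos]
  linarith [hx.1]

theorem hasDerivAt_sqrt_one_sub {x : ℝ} (hx : x ∈ Set.Ioo (0 : ℝ) 1) :
    HasDerivAt (fun x => √(1 - x)) (-1 / (2 * √(1 - x))) x :=
  ((hasDerivAt_id x).const_sub 1).sqrt (by simpa [sub_eq_zero] using hx.2.ne')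

/-- As √(1-x) decreases in x, an increasing g gives a decreasing derivative. -/
theorem concaveOn_and_monotoneOn_of_hasDerivAt {f g : ℝ → ℝ} (hf : ContinuousOn f (Set.Icc 0 1))
    (hd : ∀ x ∈ Set.Ioo (0 : ℝ) 1, HasDerivAt f (g (√(1 - x))) x)
    (hg : MonotoneOn g (Set.Ioo 0 1)) (hg0 : ∀ y ∈ Set.Ioo (0 : ℝ) 1, 0 ≤ g y) :
    ConcaveOn ℝ (Set.Icc 0 1) f ∧ MonotoneOn f (Set.Icc 0 1) := by
  have hdiff : DifferentiableOn ℝ f (interior (Set.Icc 0 1)) := fun x hx =>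
    (hd x (by rwa [interior_Icc] at hx)).differentiableAt.differentiableWithinAt
  constructor
  · refine AntitoneOn.concaveOn_of_deriv (convex_Icc 0 1) hf hdiff ?_
    rw [interior_Icc]
    intro x hx y hy hxy
    rw [(hd x hx).deriv, (hd y hy).deriv]
    exact hg (sqrt_one_sub_mem_Ioo hy) (sqrt_one_sub_mem_Ioo hx) (sqrt_le_sqrt (by linarith))
  · refine monotoneOn_of_deriv_nonneg (convex_Icc 0 1) hf hdiff ?_
    rw [interior_Icc]
    intro x hx
    rw [(hd x hx).deriv]
    exact hg0 _ (sqrt_one_sub_mem_Ioo hx)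

/-- Up to a constant, the derivative of the binary Rényi entropy in the squared concurrence
`1 - y ^ 2`. -/
noncomputable def renyiSlope (β y : ℝ) : ℝ :=
  (((1 + y) / 2) ^ β - ((1 - y) / 2) ^ β) /
    (β * (y * (((1 + y) / 2) ^ (1 + β) + ((1 - y) / 2) ^ (1 + β))))

/-- Since (1 ± tanh t)/2 = e^{±t}/(2 cosh t), real powers become exponentials. -/
theorem renyiSlope_tanh (β t : ℝ) :
    renyiSlope β (tanh t) =
      2 * (sinh (β * t) * cosh t ^ 2 / (β * (sinh t * cosh ((1 + β) * t)))) := by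
  have hc := cosh_pos t
  have hp : (1 + tanh t) / 2 = exp t / (2 * cosh t) := by
    rw [tanh_eq_sinh_div_cosh, ← cosh_add_sinh]; field_simp
  have hq : (1 - tanh t) / 2 = exp (-t) / (2 * cosh t) := by
    rw [tanh_eq_sinh_div_cosh, ← cosh_sub_sinh]; field_simp
  have hpow : ∀ s γ : ℝ, (exp s / (2 * cosh t)) ^ γ = exp (γ * s) / (2 * cosh t) ^ γ := by
    intro s γ
    rw [div_rpow (exp_pos _).le (by positivity), ← exp_mul, mul_comm]
  have hs : ∀ γ : ℝ, exp (γ * t) - exp (γ * -t) = 2 * sinh (γ * t) := by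
    intro γ; rw [sinh_eq, mul_neg]; ring
  have hh : ∀ γ : ℝ, exp (γ * t) + exp (γ * -t) = 2 * cosh (γ * t) := by
    intro γ; rw [cosh_eq, mul_neg]; ring
  unfold renyiSlope
  rw [hp, hq]
  simp only [hpow]
  rw [← sub_div, ← add_div, hs, hh, tanh_eq_sinh_div_cosh, rpow_add (by positivity), rpow_one]
  have h1 : (2 * cosh t) ^ β ≠ 0 := (rpow_pos_of_pos (by positivity) _).ne'
  have h2 := (cosh_pos ((1 + β) * t)).ne'
  rcases eq_or_ne β 0 with rfl | hβ
  · simp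
  rcases eq_or_ne (sinh t) 0 with h | h
  · simp [h]
  field_simp

theorem artanh_monotoneOn_Ioo : MonotoneOn artanh (Set.Ioo 0 1) := fun _ hx _ hy h =>
  artanh_le_artanh (by linarith [hx.1]) hy.2 h

theorem renyiSlope_monotoneOn {β : ℝ} (hβ : -1 / 2 ≤ β) (h : β ^ 2 + 3 * β ≤ 1) (h0 : β ≠ 0) :
    MonotoneOn (renyiSlope β) (Set.Ioo 0 1) := by
  intro x hx y hy hxy
  rw [← tanh_artanh (x := x) ⟨by linarith [hx.1], hx.2⟩,
    ← tanh_artanh (x := y) ⟨by linarith [hy.1], hy.2⟩, renyiSlope_tanh, renyiSlope_tanh]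
  exact mul_le_mul_of_nonneg_left (sinh_ratio_monotoneOn hβ h h0 (artanh_pos hx) (artanh_pos hy)
    (artanh_monotoneOn_Ioo hx hy hxy)) zero_le_two

theorem renyiSlope_nonneg {β y : ℝ} (hy : y ∈ Set.Ioo (0 : ℝ) 1) : 0 ≤ renyiSlope β y := by
  have hq : 0 < (1 - y) / 2 := by linarith [hy.2]
  have hpq : (1 - y) / 2 ≤ (1 + y) / 2 := by linarith [hy.1]
  have hp := hq.trans_le hpq
  have hd : 0 ≤ y * (((1 + y) / 2) ^ (1 + β) + ((1 - y) / 2) ^ (1 + β)) :=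
    mul_nonneg hy.1.le (by positivity)
  unfold renyiSlope
  rcases le_total 0 β with h | h
  · exact div_nonneg (sub_nonneg.2 (rpow_le_rpow hq.le hpq h)) (mul_nonneg h hd)
  · exact div_nonneg_of_nonpos (sub_nonpos.2 (rpow_le_rpow_of_nonpos hq hpq h))
      (mul_nonpos_of_nonpos_of_nonneg h hd)

theorem hasDerivAt_renyiOfSqConcurrence {α x : ℝ} (hα : α ≠ 1) (hx : x ∈ Set.Ioo (0 : ℝ) 1) :
    HasDerivAt (renyiOfSqConcurrence α) (α / (4 * log 2) * renyiSlope (α - 1) (√(1 - x))) x := by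
  obtain ⟨hy0, hy1⟩ := sqrt_one_sub_mem_Ioo hx
  have hy := hasDerivAt_sqrt_one_sub hx
  have hq : 0 < (1 - √(1 - x)) / 2 := by linarith
  have hp : 0 < (1 + √(1 - x)) / 2 := by linarith
  have hP := ((hy.const_add 1).div_const 2).rpow_const (p := α) (Or.inl hp.ne')
  have hQ := ((hy.const_sub 1).div_const 2).rpow_const (p := α) (Or.inl hq.ne')
  have hS := add_pos (rpow_pos_of_pos hp α) (rpow_pos_of_pos hq α)
  have h := ((hP.add hQ).log hS.ne').div_const (log 2) |>.const_mul (1 / (1 - α))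
  have hf : renyiOfSqConcurrence α = fun x => 1 / (1 - α) *
      (log (((1 + √(1 - x)) / 2) ^ α + ((1 - √(1 - x)) / 2) ^ α) / log 2) := by
    ext x
    simp only [renyiOfSqConcurrence, binaryRenyi, if_neg hα, logb]
  rw [hf]
  refine HasDerivAt.congr_deriv h ?_
  simp only [renyiSlope, add_sub_cancel, Pi.add_apply]
  have h1 : 1 - α ≠ 0 := sub_ne_zero.2 hα.symm
  have h2 : α - 1 ≠ 0 := sub_ne_zero.2 hα
  have h3 : log 2 ≠ 0 := (log_pos one_lt_two).ne'
  have e1 : 1 / (1 - α) = -(1 / (α - 1)) := by rw [← neg_sub, one_div, one_div, inv_neg]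
  rw [e1]
  generalize ((1 + √(1 - x)) / 2) ^ α = P at *
  generalize ((1 - √(1 - x)) / 2) ^ α = Q at *
  have hS' := hS.ne'
  field_simp
  ring

theorem continuousOn_renyiOfSqConcurrence_of_ne_one {α : ℝ} (hα : 0 < α) (h1 : α ≠ 1) :
    ContinuousOn (renyiOfSqConcurrence α) (Set.Icc 0 1) := by
  have hf : renyiOfSqConcurrence α = fun x => 1 / (1 - α) *
      (log (((1 + √(1 - x)) / 2) ^ α + ((1 - √(1 - x)) / 2) ^ α) / log 2) := by
    ext x
    simp only [renyiOfSqConcurrence, binaryRenyi, if_neg h1, logb]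
  have hr := continuous_rpow_const hα.le
  have hc : Continuous fun x : ℝ => ((1 + √(1 - x)) / 2) ^ α + ((1 - √(1 - x)) / 2) ^ α :=
    (hr.comp (by fun_prop)).add (hr.comp (by fun_prop))
  rw [hf]
  refine continuousOn_const.mul ((hc.continuousOn.log fun x hx => ?_).div_const _)
  have hp : 0 < (1 + √(1 - x)) / 2 := by positivity
  have hq : 0 ≤ (1 - √(1 - x)) / 2 := by
    have : √(1 - x) ≤ 1 := sqrt_le_one.2 (by linarith [hx.1])
    linarith
  exact (add_pos_of_pos_of_nonneg (rpow_pos_of_pos hp α) (rpow_nonneg hq α)).ne'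

theorem renyiOfSqConcurrence_one (x : ℝ) :
    renyiOfSqConcurrence 1 x = binEntropy ((1 + √(1 - x)) / 2) / log 2 := by
  have e : 1 - (1 + √(1 - x)) / 2 = (1 - √(1 - x)) / 2 := by ring
  rw [renyiOfSqConcurrence, binaryRenyi, if_pos rfl, binEntropy, e, log_inv, log_inv, logb, logb]
  ring

theorem hasDerivAt_renyiOfSqConcurrence_one {x : ℝ} (hx : x ∈ Set.Ioo (0 : ℝ) 1) :
    HasDerivAt (renyiOfSqConcurrence 1)
      (1 / (4 * log 2) * ((log (1 + √(1 - x)) - log (1 - √(1 - x))) / √(1 - x))) x := by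
  obtain ⟨hy0, hy1⟩ := sqrt_one_sub_mem_Ioo hx
  have hy := ((hasDerivAt_sqrt_one_sub hx).const_add 1).div_const 2
  have h := ((hasDerivAt_binEntropy (p := (1 + √(1 - x)) / 2) (by linarith) (by linarith)).comp x
    hy).div_const (log 2)
  rw [show renyiOfSqConcurrence 1 = fun x => binEntropy ((1 + √(1 - x)) / 2) / log 2 from
    funext renyiOfSqConcurrence_one]
  refine HasDerivAt.congr_deriv h ?_
  have e : 1 - (1 + √(1 - x)) / 2 = (1 - √(1 - x)) / 2 := by ring
  have h3 : log 2 ≠ 0 := (log_pos one_lt_two).ne'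
  rw [e, log_div (by linarith) two_ne_zero, log_div (by linarith) two_ne_zero]
  field_simp
  ring

/-- Nonnegative coefficients make the α = 1 slope nonnegative and increasing term by term. -/
theorem hasSum_log_sub_log_div {y : ℝ} (hy : y ∈ Set.Ioo (0 : ℝ) 1) :
    HasSum (fun k : ℕ => 2 * (1 / (2 * (k : ℝ) + 1)) * y ^ (2 * k))
      ((log (1 + y) - log (1 - y)) / y) := by
  have h := (hasSum_log_sub_log_of_abs_lt_one (x := y) (by rw [abs_of_pos hy.1]; exact hy.2)).div_const y
  refine h.congr_fun fun k => ?_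
  have := hy.1.ne'
  field_simp
  ring

theorem renyiOfSqConcurrence_concaveOn_and_monotoneOn {α : ℝ} (hα : 1 / 2 ≤ α)
    (h : α ^ 2 + α ≤ 3) :
    ConcaveOn ℝ (Set.Icc 0 1) (renyiOfSqConcurrence α) ∧
      MonotoneOn (renyiOfSqConcurrence α) (Set.Icc 0 1) := by
  have hl := log_pos one_lt_two
  rcases eq_or_ne α 1 with rfl | h1
  · refine concaveOn_and_monotoneOn_of_hasDerivAt
      (g := fun y => 1 / (4 * log 2) * ((log (1 + y) - log (1 - y)) / y)) ?_
      (fun x hx => hasDerivAt_renyiOfSqConcurrence_one hx) (fun x hx y hy hxy => ?_)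
      (fun y hy => ?_)
    · rw [show renyiOfSqConcurrence 1 = fun x => binEntropy ((1 + √(1 - x)) / 2) / log 2 from
        funext renyiOfSqConcurrence_one]
      fun_prop
    · refine mul_le_mul_of_nonneg_left (hasSum_le (fun k => ?_) (hasSum_log_sub_log_div hx)
        (hasSum_log_sub_log_div hy)) (by positivity)
      exact mul_le_mul_of_nonneg_left (pow_le_pow_left₀ hx.1.le hxy _) (by positivity)
    · have := hy.1
      exact mul_nonneg (by positivity)
        ((hasSum_log_sub_log_div hy).nonneg fun k => by positivity)
  · have hc : 0 ≤ α / (4 * log 2) := div_nonneg (by linarith) (by positivity)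
    exact concaveOn_and_monotoneOn_of_hasDerivAt
      (g := fun y => α / (4 * log 2) * renyiSlope (α - 1) y)
      (continuousOn_renyiOfSqConcurrence_of_ne_one (by linarith) h1)
      (fun x hx => hasDerivAt_renyiOfSqConcurrence h1 hx)
      (fun x hx y hy hxy => mul_le_mul_of_nonneg_left
        (renyiSlope_monotoneOn (by linarith) (by linarith) (sub_ne_zero.2 h1) hx hy hxy) hc)
      (fun y hy => mul_nonneg hc (renyiSlope_nonneg hy))

theorem renyiOfSqConcurrence_zero {α : ℝ} (hα : 0 < α) : renyiOfSqConcurrence α 0 = 0 := by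
  simp [renyiOfSqConcurrence, binaryRenyi, zero_rpow hα.ne']

/-! ### Subadditivity and the weighted power inequality. -/

/-- Both f x and f y lie above the chord from 0 to x + y; add the two bounds. -/
theorem _root_.ConcaveOn.subadditive_of_zero {f : ℝ → ℝ} {c : ℝ}
    (hf : ConcaveOn ℝ (Set.Icc 0 c) f)
    (h0 : 0 ≤ f 0) {x y : ℝ} (hx : 0 ≤ x) (hy : 0 ≤ y) (hxy : x + y ≤ c) :
    f (x + y) ≤ f x + f y := by
  rcases (add_nonneg hx hy).eq_or_lt with hs | hs
  · have hx' : x = 0 := by linarith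
    have hy' : y = 0 := by linarith
    subst hx' hy'
    simpa using h0
  have key : ∀ u v : ℝ, 0 ≤ u → 0 ≤ v → u + v = x + y → u / (x + y) * f (x + y) ≤ f u := by
    intro u v hu hv huv
    have h := hf.2 (x := x + y) (y := 0) ⟨hs.le, hxy⟩ ⟨le_rfl, hs.le.trans hxy⟩
      (div_nonneg hu hs.le) (div_nonneg hv hs.le) (by rw [← add_div, huv, div_self hs.ne'])
    simp only [smul_eq_mul, mul_zero, add_zero, div_mul_cancel₀ _ hs.ne'] at h
    have := mul_nonneg (div_nonneg hv hs.le) h0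
    linarith
  have h1 := key x y hx hy rfl
  have h2 := key y x hy hx (add_comm _ _)
  have h3 : x / (x + y) * f (x + y) + y / (x + y) * f (x + y) = f (x + y) := by
    field_simp
  linarith

/-- `(1 + t) ^ μ ≤ 1 + (2 ^ μ - 1) t ^ μ` on `[0, 1]`, in homogeneous form. -/
theorem add_rpow_le_add_two_rpow_sub_one_mul {μ x y : ℝ} (hμ0 : 0 ≤ μ) (hμ1 : μ ≤ 1)
    (hy : 0 ≤ y) (hyx : y ≤ x) : (x + y) ^ μ ≤ x ^ μ + (2 ^ μ - 1) * y ^ μ := by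
  have h2 : 0 ≤ (2 : ℝ) ^ μ - 1 := sub_nonneg.2 (one_le_rpow one_le_two hμ0)
  rcases (hy.trans hyx).eq_or_lt with rfl | hx
  · obtain rfl : y = 0 := le_antisymm hyx hy
    have := mul_nonneg h2 (rpow_nonneg hy μ)
    simpa using this
  have hl0 : 0 ≤ y / x := by positivity
  have hl1 : 0 ≤ 1 - y / x := sub_nonneg.2 ((div_le_one hx).2 hyx)
  have hg := concaveOn_rpow hμ0 hμ1
  -- The pairs {2y, x} and {y, x+y} have the same sum and the second encloses the first, so
  -- concavity gives y^μ + (x+y)^μ ≤ (2y)^μ + x^μ.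
  have ha := hg.2 (x := y) (y := x + y) hy (add_nonneg hx.le hy) hl1 hl0 (by ring)
  have hb := hg.2 (x := y) (y := x + y) hy (add_nonneg hx.le hy) hl0 hl1 (by ring)
  have ea : (1 - y / x) • y + (y / x) • (x + y) = 2 * y := by
    simp only [smul_eq_mul]; field_simp; ring
  have eb : (y / x) • y + (1 - y / x) • (x + y) = x := by
    simp only [smul_eq_mul]; field_simp; ring
  rw [ea] at ha
  rw [eb] at hb
  simp only [smul_eq_mul, mul_rpow zero_le_two hy] at ha hb
  linarith

theorem rpow_apply_sum_le {f : ℝ → ℝ} {μ : ℝ} (hμ0 : 0 ≤ μ) (hμ1 : μ ≤ 1)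
    (hf0 : ∀ x ∈ Set.Icc (0 : ℝ) 1, 0 ≤ f x) (hmono : MonotoneOn f (Set.Icc 0 1))
    (hsub : ∀ x y, 0 ≤ x → 0 ≤ y → x + y ≤ 1 → f (x + y) ≤ f x + f y) (n : ℕ)
    (c : Fin (n + 1) → ℝ) (hc : ∀ i, 0 ≤ c i) (hs : ∑ i, c i ≤ 1)
    (hord : ∀ i : Fin (n + 1), (i : ℕ) + 1 < n + 1 → ∑ j ∈ Finset.Ioi i, c j ≤ c i) :
    f (∑ i, c i) ^ μ ≤ ∑ i : Fin (n + 1), ((2 : ℝ) ^ μ - 1) ^ (i : ℕ) * f (c i) ^ μ := by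
  induction n with
  | zero => simp
  | succ n ih =>
    rw [Fin.sum_univ_succ] at hs ⊢
    have hr0 : 0 ≤ ∑ i : Fin (n + 1), c i.succ := Finset.sum_nonneg fun i _ => hc _
    have hrs : ∑ i : Fin (n + 1), c i.succ ≤ 1 := by linarith [hc 0]
    have hIoi : ∀ i : Fin (n + 1), ∑ j ∈ Finset.Ioi i.succ, c j = ∑ j ∈ Finset.Ioi i, c j.succ := by
      intro i
      rw [← Fin.map_succEmb_Ioi, Finset.sum_map]
      rfl
    have hle : ∑ i : Fin (n + 1), c i.succ ≤ c 0 := by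
      have := hord 0 (by simp)
      rwa [Fin.Ioi_zero_eq_map, Finset.sum_map] at this
    have ih' := ih (fun i => c i.succ) (fun i => hc _) hrs fun i hi => by
      rw [← hIoi]
      exact hord i.succ (by simpa using hi)
    have hc0 : c 0 ∈ Set.Icc (0 : ℝ) 1 := ⟨hc 0, by linarith⟩
    have hrm : ∑ i : Fin (n + 1), c i.succ ∈ Set.Icc (0 : ℝ) 1 := ⟨hr0, hrs⟩
    have h2 : 0 ≤ (2 : ℝ) ^ μ - 1 := sub_nonneg.2 (one_le_rpow one_le_two hμ0)
    calc f (c 0 + ∑ i : Fin (n + 1), c i.succ) ^ μ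
        ≤ (f (c 0) + f (∑ i : Fin (n + 1), c i.succ)) ^ μ :=
          rpow_le_rpow (hf0 _ ⟨add_nonneg (hc 0) hr0, hs⟩) (hsub _ _ (hc 0) hr0 hs) hμ0
      _ ≤ f (c 0) ^ μ + (2 ^ μ - 1) * f (∑ i : Fin (n + 1), c i.succ) ^ μ :=
          add_rpow_le_add_two_rpow_sub_one_mul hμ0 hμ1 (hf0 _ hrm) (hmono hrm hc0 hle)
      _ ≤ f (c 0) ^ μ + (2 ^ μ - 1) *
            ∑ i : Fin (n + 1), ((2 : ℝ) ^ μ - 1) ^ (i : ℕ) * f (c i.succ) ^ μ := by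
          gcongr
      _ = _ := by
          rw [Fin.sum_univ_succ (n := n + 1), Finset.mul_sum]
          simp [pow_succ', mul_assoc]

end QInfo

/-! ### Pure states of a qubit and another system. -/

namespace QInfo

open scoped ComplexOrder

theorem reducedA_apply {a b : Type*} [Fintype b] (ψ : a × b → ℂ) (i j : a) :
    reducedA ψ i j = ∑ k, ψ (i, k) * star (ψ (j, k)) := by
  simp [reducedA, partialTraceB, pureDensity, Matrix.vecMulVec_apply]

theorem reducedA_posSemidef {a b : Type*} [Fintype a] [Fintype b] (ψ : a × b → ℂ) :
    (reducedA ψ).PosSemidef := by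
  have h : reducedA ψ = (Matrix.of fun i k => ψ (i, k)) * (Matrix.of fun i k => ψ (i, k))ᴴ := by
    ext i j
    simp [reducedA_apply, Matrix.mul_apply]
  rw [h]
  exact Matrix.posSemidef_self_mul_conjTranspose _

theorem trace_reducedA {a b : Type*} [Fintype a] [Fintype b] {ψ : a × b → ℂ}
    (hψ : IsUnitVector ψ) : (reducedA ψ).trace = 1 := by
  have h : ((∑ x, ‖ψ x‖ ^ 2 : ℝ) : ℂ) = 1 := by rw [hψ]; simp
  rw [← h, Fintype.sum_prod_type]
  simp [Matrix.trace, reducedA_apply, Complex.mul_conj']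

section Qubit

variable {b : Type*} [Fintype b]

/-- The squared concurrence of a pure state of a qubit and another system. -/
noncomputable def sqConcurrence (ψ : Fin 2 × b → ℂ) : ℝ := 4 * (reducedA ψ).det.re

theorem eigenvalues_add_eq_one {ψ : Fin 2 × b → ℂ} (hψ : IsUnitVector ψ) :
    (reducedA_isHermitian ψ).eigenvalues 0 + (reducedA_isHermitian ψ).eigenvalues 1 = 1 := by
  have h := (reducedA_isHermitian ψ).trace_eq_sum_eigenvalues
  rw [trace_reducedA hψ, Fin.sum_univ_two] at h
  exact Complex.ofReal_injective (by push_cast; exact h.symm)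

theorem sqConcurrence_eq_eigenvalues (ψ : Fin 2 × b → ℂ) :
    sqConcurrence ψ = 4 * ((reducedA_isHermitian ψ).eigenvalues 0 *
      (reducedA_isHermitian ψ).eigenvalues 1) := by
  rw [sqConcurrence, (reducedA_isHermitian ψ).det_eq_prod_eigenvalues, Fin.prod_univ_two]
  norm_cast

theorem sqConcurrence_mem_Icc {ψ : Fin 2 × b → ℂ} (hψ : IsUnitVector ψ) :
    sqConcurrence ψ ∈ Set.Icc (0 : ℝ) 1 := by
  have h0 := (reducedA_posSemidef ψ).eigenvalues_nonneg 0
  have h1 := (reducedA_posSemidef ψ).eigenvalues_nonneg 1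
  have hs := eigenvalues_add_eq_one hψ
  rw [sqConcurrence_eq_eigenvalues]
  constructor
  · exact mul_nonneg (by norm_num) (mul_nonneg h0 h1)
  · nlinarith [sq_nonneg ((reducedA_isHermitian ψ).eigenvalues 0 -
      (reducedA_isHermitian ψ).eigenvalues 1)]

theorem renyiEntanglementPure_eq (α : ℝ) {ψ : Fin 2 × b → ℂ} (hψ : IsUnitVector ψ) :
    renyiEntanglementPure α ψ = renyiOfSqConcurrence α (sqConcurrence ψ) := by
  have hs := eigenvalues_add_eq_one hψ
  have hE : renyiEntanglementPure α ψ = binaryRenyi α ((reducedA_isHermitian ψ).eigenvalues 0)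
      ((reducedA_isHermitian ψ).eigenvalues 1) := by
    simp only [renyiEntanglementPure, renyiEntropy, binaryRenyi, Fin.sum_univ_two]
  rw [hE, renyiOfSqConcurrence, sqConcurrence_eq_eigenvalues]
  generalize (reducedA_isHermitian ψ).eigenvalues 0 = u at *
  generalize (reducedA_isHermitian ψ).eigenvalues 1 = v at *
  obtain rfl : v = 1 - u := by linarith
  have e : 1 - 4 * (u * (1 - u)) = (2 * u - 1) ^ 2 := by ring
  rw [e, Real.sqrt_sq_eq_abs]
  -- Either eigenvalue may be the larger one; symmetry of the entropy covers both orders.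
  rcases abs_choice (2 * u - 1) with h | h
  · rw [h]
    congr 1 <;> ring
  · rw [h, binaryRenyi_comm]
    congr 1 <;> ring

theorem concurrencePure_eq {ψ : Fin 2 × b → ℂ} (hψ : IsUnitVector ψ) :
    concurrencePure ψ = √(sqConcurrence ψ) := by
  have h1 := trace_reducedA hψ
  rw [Matrix.trace_fin_two] at h1
  have h : (reducedA ψ * reducedA ψ).trace = 1 - 2 * (reducedA ψ).det := by
    rw [Matrix.det_fin_two, Matrix.trace_fin_two, Matrix.mul_apply, Matrix.mul_apply,
      Fin.sum_univ_two, Fin.sum_univ_two]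
    linear_combination (reducedA ψ 0 0 + reducedA ψ 1 1 + 1) * h1
  rw [concurrencePure, h, sqConcurrence]
  congr 1
  simp
  ring

/-- With a single amplitude in the row A = 1, the amplitude at (0, e₀) cancels from the 2×2
determinant. -/
theorem sqConcurrence_of_support [DecidableEq b] {ψ : Fin 2 × b → ℂ} (e₀ : b)
    (h : ∀ e, e ≠ e₀ → ψ (1, e) = 0) :
    sqConcurrence ψ = 4 * (‖ψ (1, e₀)‖ ^ 2 * ∑ e ∈ Finset.univ.erase e₀, ‖ψ (0, e)‖ ^ 2) := by
  have h11 : reducedA ψ 1 1 = ψ (1, e₀) * star (ψ (1, e₀)) := by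
    rw [reducedA_apply]
    exact Fintype.sum_eq_single e₀ fun e he => by simp [h e he]
  have h01 : reducedA ψ 0 1 = ψ (0, e₀) * star (ψ (1, e₀)) := by
    rw [reducedA_apply]
    exact Fintype.sum_eq_single e₀ fun e he => by simp [h e he]
  have h10 : reducedA ψ 1 0 = ψ (1, e₀) * star (ψ (0, e₀)) := by
    rw [reducedA_apply]
    exact Fintype.sum_eq_single e₀ fun e he => by simp [h e he]
  have h00 : reducedA ψ 0 0 = ψ (0, e₀) * star (ψ (0, e₀)) +
      ((∑ e ∈ Finset.univ.erase e₀, ‖ψ (0, e)‖ ^ 2 : ℝ) : ℂ) := by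
    rw [reducedA_apply, ← Finset.add_sum_erase _ _ (Finset.mem_univ e₀)]
    simp [Complex.mul_conj']
  have hdet : (reducedA ψ).det =
      ((‖ψ (1, e₀)‖ ^ 2 * ∑ e ∈ Finset.univ.erase e₀, ‖ψ (0, e)‖ ^ 2 : ℝ) : ℂ) := by
    rw [Matrix.det_fin_two, h00, h01, h10, h11, Complex.ofReal_mul, Complex.ofReal_pow,
      ← Complex.mul_conj']
    simp only [Complex.star_def]
    ring
  rw [sqConcurrence, hdet, Complex.ofReal_re]

end Qubit

/-! ### Decompositions of a pure state. -/

section Pure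

variable {d : Type*} [Fintype d]

theorem pureDensity_smul {d : Type*} (c : ℂ) (ψ : d → ℂ) :
    pureDensity (c • ψ) = ((‖c‖ ^ 2 : ℝ) : ℂ) • pureDensity ψ := by
  ext i j
  simp only [pureDensity, Matrix.vecMulVec_apply, Matrix.smul_apply, Pi.smul_apply, Pi.star_apply,
    smul_eq_mul, star_mul', Complex.ofReal_pow, ← Complex.mul_conj', Complex.star_def]
  ring

theorem IsUnitVector.star_dotProduct_self {ψ : d → ℂ} (h : IsUnitVector ψ) : star ψ ⬝ᵥ ψ = 1 := by
  have h' : ((∑ x, ‖ψ x‖ ^ 2 : ℝ) : ℂ) = 1 := by rw [h]; simp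
  rw [← h']
  simp [dotProduct, Complex.conj_mul']

theorem star_dotProduct_pureDensity_mulVec (v φ : d → ℂ) :
    star v ⬝ᵥ (pureDensity φ *ᵥ v) = ((‖star v ⬝ᵥ φ‖ ^ 2 : ℝ) : ℂ) := by
  have h : star φ ⬝ᵥ v = star (star v ⬝ᵥ φ) := by
    rw [Matrix.star_dotProduct]
  rw [pureDensity, Matrix.vecMulVec_mulVec, h]
  simp [Complex.conj_mul']

theorem PureDecomposition.sum_sq_norm {ρ : Matrix d d ℂ} (D : PureDecomposition ρ) (v : d → ℂ) :
    star v ⬝ᵥ (ρ *ᵥ v) = ((∑ i, D.p i * ‖star v ⬝ᵥ D.ψ i‖ ^ 2 : ℝ) : ℂ) := by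
  conv_lhs => rw [D.decomp]
  rw [Matrix.sum_mulVec, dotProduct_sum, Complex.ofReal_sum]
  refine Finset.sum_congr rfl fun i _ => ?_
  rw [Matrix.smul_mulVec, dotProduct_smul, star_dotProduct_pureDensity_mulVec]
  simp

/-- Let v be the part of a member orthogonal to ψ. Then ⟨v|ρ|v⟩ = 0 forces v to be orthogonal to
that member as well, so v = 0 and only a phase remains. -/
theorem PureDecomposition.pureDensity_eq {ψ : d → ℂ} (hψ : IsUnitVector ψ)
    (D : PureDecomposition (pureDensity ψ)) {i : Fin D.n} (hi : D.p i ≠ 0) :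
    pureDensity (D.ψ i) = pureDensity ψ := by
  set c := star ψ ⬝ᵥ D.ψ i with hc
  set v := D.ψ i - c • ψ with hv
  have hψv : star ψ ⬝ᵥ v = 0 := by
    rw [hv, dotProduct_sub, dotProduct_smul, hψ.star_dotProduct_self, ← hc]
    simp
  have hvψ : star v ⬝ᵥ ψ = 0 := by
    rw [Matrix.star_dotProduct, hψv, star_zero]
  have hsum := D.sum_sq_norm v
  rw [star_dotProduct_pureDensity_mulVec, hvψ, norm_zero] at hsum
  have hsum' : ∑ i, D.p i * ‖star v ⬝ᵥ D.ψ i‖ ^ 2 = 0 := by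
    have := Complex.ofReal_injective hsum
    simpa using this.symm
  rw [Finset.sum_eq_zero_iff_of_nonneg
    (fun j _ => mul_nonneg (D.p_nonneg j) (sq_nonneg _))] at hsum'
  have hvi : star v ⬝ᵥ D.ψ i = 0 := by simpa [hi] using hsum' i (Finset.mem_univ i)
  have hvv : star v ⬝ᵥ v = 0 := by
    conv_lhs => rw [hv]
    rw [dotProduct_sub, dotProduct_smul, hvψ, hvi]
    simp
  have hv0 : v = 0 := dotProduct_star_self_eq_zero.1 hvv
  have hψi : D.ψ i = c • ψ := sub_eq_zero.1 hv0
  have hnc : ‖c‖ ^ 2 = 1 := by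
    have h := D.unit i
    rw [hψi, IsUnitVector] at h
    simp only [Pi.smul_apply, smul_eq_mul, norm_mul, mul_pow, ← Finset.mul_sum] at h
    rwa [show ∑ x, ‖ψ x‖ ^ 2 = 1 from hψ, mul_one] at h
  rw [hψi, pureDensity_smul, hnc]
  simp

end Pure

end QInfo

namespace QInfo

/-! ### W-class vectors and their marginals. -/

section WClass

variable {κ : Type*} [Fintype κ] [DecidableEq κ]

/-- The unnormalized single-excitation vector `∑ k, b k |0⋯1_k⋯0⟩`. -/
noncomputable def excitation (b : κ → ℂ) : (κ → Fin 2) → ℂ := fun e =>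
  ∑ k, if e = Pi.single k 1 then b k else 0

theorem pi_single_one_ne_zero {κ : Type*} [DecidableEq κ] (k : κ) : (0 : κ → Fin 2) ≠ Pi.single k 1 := fun h => by
  simpa using congrFun h k

theorem pi_single_one_injective {κ : Type*} [DecidableEq κ] :
    Function.Injective fun k : κ => (Pi.single k 1 : κ → Fin 2) := by
  intro j k h
  by_contra hne
  have := congrFun h j
  simp [Pi.single_eq_of_ne hne] at this

theorem excitation_zero (b : κ → ℂ) : excitation b 0 = 0 := by
  simp [excitation, pi_single_one_ne_zero]

theorem excitation_single (b : κ → ℂ) (k : κ) : excitation b (Pi.single k 1) = b k := by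
  rw [excitation, Fintype.sum_eq_single k fun j hj =>
    if_neg fun h => hj (pi_single_one_injective h).symm]
  simp

theorem sum_sq_norm_excitation (b : κ → ℂ) : ∑ e, ‖excitation b e‖ ^ 2 = ∑ k, ‖b k‖ ^ 2 := by
  symm
  refine Fintype.sum_of_injective _ pi_single_one_injective _ _ (fun e he => ?_) fun k => ?_
  · have : excitation b e = 0 :=
      Finset.sum_eq_zero fun k _ => if_neg fun h => he ⟨k, h.symm⟩
    simp [this]
  · simp only [excitation_single]

/-- The vector `a|1⟩|0⋯0⟩ + |0⟩(r|0⋯0⟩ + ∑ k, b k |0⋯1_k⋯0⟩)`. -/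
noncomputable def wVector (a r : ℂ) (b : κ → ℂ) : Qubits κ → ℂ := fun x =>
  if x.1 = 1 then (if x.2 = 0 then a else 0) else (if x.2 = 0 then r else 0) + excitation b x.2

theorem wState_eq_wVector {n : ℕ} (a : ℂ) (b : Fin n → ℂ) : wState a b = wVector a 0 b := by
  ext ⟨i, e⟩
  fin_cases i <;>
    simp [wState, wVector, excitation, ket, Pi.single_apply, Prod.ext_iff]

theorem sum_sq_norm_wVector (a r : ℂ) (b : κ → ℂ) :
    ∑ x, ‖wVector a r b x‖ ^ 2 = ‖a‖ ^ 2 + ‖r‖ ^ 2 + ∑ k, ‖b k‖ ^ 2 := by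
  have h0 : ∀ e : κ → Fin 2, ‖wVector a r b (0, e)‖ ^ 2 =
      (if e = 0 then ‖r‖ ^ 2 else 0) + ‖excitation b e‖ ^ 2 := by
    intro e
    by_cases he : e = 0 <;> simp [wVector, he, excitation_zero]
  have h1 : ∀ e : κ → Fin 2, ‖wVector a r b (1, e)‖ ^ 2 = if e = 0 then ‖a‖ ^ 2 else 0 := by
    intro e
    by_cases he : e = 0 <;> simp [wVector, he]
  rw [Fintype.sum_prod_type, Fin.sum_univ_two]
  simp only [h0, h1, Finset.sum_add_distrib, sum_sq_norm_excitation]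
  simp
  ring

/-- Independence of the ground amplitude r is what lets one decomposition serve both concurrence and
assistance. -/
theorem sqConcurrence_wVector (a r : ℂ) (b : κ → ℂ) :
    sqConcurrence (wVector a r b) = 4 * (‖a‖ ^ 2 * ∑ k, ‖b k‖ ^ 2) := by
  rw [sqConcurrence_of_support 0 fun e he => by simp [wVector, he]]
  have h : ∑ e ∈ Finset.univ.erase (0 : κ → Fin 2), ‖wVector a r b (0, e)‖ ^ 2 =
      ∑ k, ‖b k‖ ^ 2 := by
    rw [← sum_sq_norm_excitation, ← Finset.add_sum_erase _ _ (Finset.mem_univ (0 : κ → Fin 2)),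
      excitation_zero]
    simp only [norm_zero, ne_eq, OfNat.ofNat_ne_zero, not_false_eq_true, zero_pow, zero_add]
    refine Finset.sum_congr rfl fun e he => ?_
    simp [wVector, Finset.ne_of_mem_erase he]
  rw [h]
  simp [wVector]

/-- The mixture of the vector `a|1⟩|0⋯0⟩ + ∑ k, b k |0⟩|0⋯1_k⋯0⟩` with weight `s` on the ground
state. -/
noncomputable def wMixture (a : ℂ) (b : κ → ℂ) (s : ℝ) : Matrix (Qubits κ) (Qubits κ) ℂ :=
  pureDensity (wVector a 0 b) + (s : ℂ) • pureDensity (ket (0, 0))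

theorem piEquiv_symm_eq_zero_iff {κ : Type*} [DecidableEq κ]
    (S : Finset κ) (x : {k // k ∈ S} → Fin 2)
    (e : {k // k ∉ S} → Fin 2) :
    (Equiv.piEquivPiSubtypeProd (· ∈ S) fun _ => Fin 2).symm (x, e) = 0 ↔ x = 0 ∧ e = 0 := by
  rw [Equiv.symm_apply_eq, Prod.ext_iff]
  rfl

theorem piEquiv_symm_eq_single_iff_of_mem {κ : Type*} [DecidableEq κ]
    (S : Finset κ) (x : {k // k ∈ S} → Fin 2)
    (e : {k // k ∉ S} → Fin 2) (k : {k // k ∈ S}) :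
    (Equiv.piEquivPiSubtypeProd (· ∈ S) fun _ => Fin 2).symm (x, e) = Pi.single (k : κ) 1 ↔
      x = Pi.single k 1 ∧ e = 0 := by
  rw [Equiv.symm_apply_eq, Prod.ext_iff]
  have h1 : (fun j : {k // k ∈ S} => (Pi.single (k : κ) 1 : κ → Fin 2) j) = Pi.single k 1 := by
    funext j
    simp only [Pi.single_apply, Subtype.ext_iff]
  have h2 : (fun j : {k // k ∉ S} => (Pi.single (k : κ) 1 : κ → Fin 2) j) = 0 := by
    ext j
    have : (j : κ) ≠ k := fun h => j.2 (h ▸ k.2)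
    simp [this]
  simp only [Equiv.piEquivPiSubtypeProd_apply, h1, h2]

theorem piEquiv_symm_eq_single_iff_of_notMem {κ : Type*} [DecidableEq κ]
    (S : Finset κ) (x : {k // k ∈ S} → Fin 2)
    (e : {k // k ∉ S} → Fin 2) (k : {k // k ∉ S}) :
    (Equiv.piEquivPiSubtypeProd (· ∈ S) fun _ => Fin 2).symm (x, e) = Pi.single (k : κ) 1 ↔
      x = 0 ∧ e = Pi.single k 1 := by
  rw [Equiv.symm_apply_eq, Prod.ext_iff]
  have h1 : (fun j : {k // k ∉ S} => (Pi.single (k : κ) 1 : κ → Fin 2) j) = Pi.single k 1 := by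
    funext j
    simp only [Pi.single_apply, Subtype.ext_iff]
  have h2 : (fun j : {k // k ∈ S} => (Pi.single (k : κ) 1 : κ → Fin 2) j) = 0 := by
    ext j
    have : (j : κ) ≠ k := fun h => k.2 (h ▸ j.2)
    simp [this]
  simp only [Equiv.piEquivPiSubtypeProd_apply, h1, h2]

/-- Either the traced-out qubits are all in the ground state, or they carry the excitation and the
rest is in the ground state. -/
theorem wVector_glue (a : ℂ) (b : κ → ℂ) (S : Finset κ) (x : Qubits {k // k ∈ S})
    (e : {k // k ∉ S} → Fin 2) :
    wVector a 0 b (x.1, (Equiv.piEquivPiSubtypeProd (· ∈ S) fun _ => Fin 2).symm (x.2, e)) =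
      (if e = 0 then wVector a 0 (fun k : {k // k ∈ S} => b k) x else 0) +
      ket (0, 0) x * excitation (fun k : {k // k ∉ S} => b k) e := by
  obtain ⟨i, x⟩ := x
  have hexc : excitation b ((Equiv.piEquivPiSubtypeProd (· ∈ S) fun _ => Fin 2).symm (x, e)) =
      (if e = 0 then excitation (fun k : {k // k ∈ S} => b k) x else 0) +
      (if x = 0 then excitation (fun k : {k // k ∉ S} => b k) e else 0) := by
    rw [excitation, ← Fintype.sum_subtype_add_sum_subtype (· ∈ S)]
    simp only [piEquiv_symm_eq_single_iff_of_mem, piEquiv_symm_eq_single_iff_of_notMem]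
    congr 1
    · by_cases he : e = 0
      · simp only [he, and_true, if_true, excitation]
        exact Finset.sum_congr (by ext; simp) fun _ _ => rfl
      · simp [he]
    · by_cases hx : x = 0 <;> simp [hx, excitation]
  fin_cases i
  · simp only [wVector, hexc, ite_self, zero_add]
    by_cases he : e = 0 <;> by_cases hx : x = 0 <;> simp [ket, he, hx]
  · by_cases he : e = 0 <;> by_cases hx : x = 0 <;>
      simp [wVector, piEquiv_symm_eq_zero_iff, ket, he, hx]

theorem marginal_wVector (a : ℂ) (b : κ → ℂ) (S : Finset κ) :
    marginal (pureDensity (wVector a 0 b)) S =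
      wMixture a (fun k : {k // k ∈ S} => b k) (∑ k : {k // k ∉ S}, ‖b k‖ ^ 2) := by
  ext x y
  simp only [marginal, pureDensity, Matrix.vecMulVec_apply, Pi.star_apply, wVector_glue, wMixture,
    Matrix.add_apply, Matrix.smul_apply, smul_eq_mul]
  generalize wVector a 0 (fun k : {k // k ∈ S} => b k) = w
  have h : ∀ e : {k // k ∉ S} → Fin 2,
      ((if e = 0 then w x else 0) + ket (0, 0) x * excitation (fun k : {k // k ∉ S} => b k) e) *
        star ((if e = 0 then w y else 0) +
          ket (0, 0) y * excitation (fun k : {k // k ∉ S} => b k) e) =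
      (if e = 0 then w x * star (w y) else 0) + ket (0, 0) x * star (ket (0, 0) y) *
        ((‖excitation (fun k : {k // k ∉ S} => b k) e‖ ^ 2 : ℝ) : ℂ) := by
    intro e
    by_cases he : e = 0
    · simp [he, excitation_zero]
    · simp only [he, if_false, zero_add, Complex.ofReal_pow, ← Complex.mul_conj', star_mul',
        Complex.star_def]
      ring
  simp only [h, Finset.sum_add_distrib, ← Finset.mul_sum, ← Complex.ofReal_sum,
    sum_sq_norm_excitation]
  simp
  ring

end WClass

/-! ### Concurrence and assistance of the marginals. -/

section WMixture

variable {κ : Type*} [Fintype κ] [DecidableEq κ]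

theorem wVector_eq_add (a r : ℂ) (b : κ → ℂ) :
    wVector a r b = wVector a 0 b + r • ket (0, 0) := by
  ext ⟨i, e⟩
  fin_cases i <;> by_cases he : e = 0 <;> simp [wVector, ket, he, add_comm]

theorem wVector_isUnitVector {a r : ℂ} {b : κ → ℂ}
    (h : ‖a‖ ^ 2 + ‖r‖ ^ 2 + ∑ k, ‖b k‖ ^ 2 = 1) : IsUnitVector (wVector a r b) := by
  rw [IsUnitVector, sum_sq_norm_wVector, h]

theorem pureDensity_add_smul_add_sub {d : Type*} (φ χ : d → ℂ) (r : ℝ) :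
    (2⁻¹ : ℂ) • pureDensity (φ + (r : ℂ) • χ) + (2⁻¹ : ℂ) • pureDensity (φ + (-r : ℂ) • χ) =
      pureDensity φ + ((r ^ 2 : ℝ) : ℂ) • pureDensity χ := by
  ext i j
  simp only [pureDensity, Matrix.vecMulVec_apply, Matrix.smul_apply, Matrix.add_apply,
    Pi.add_apply, Pi.smul_apply, Pi.star_apply, smul_eq_mul, star_add, star_mul', star_neg,
    Complex.star_def, Complex.conj_ofReal, Complex.ofReal_pow]
  ring

/-- The decomposition of `wMixture a b s` into the two vectors with ground state amplitude
`±√s`, which have the same concurrence. -/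
noncomputable def wMixtureDecomposition {a : ℂ} {b : κ → ℂ} {s : ℝ} (hs : 0 ≤ s)
    (h : ‖a‖ ^ 2 + s + ∑ k, ‖b k‖ ^ 2 = 1) : PureDecomposition (wMixture a b s) where
  n := 2
  p := fun _ => 2⁻¹
  ψ := ![wVector a (√s : ℝ) b, wVector a (-(√s : ℝ)) b]
  p_nonneg := fun _ => by norm_num
  p_sum := by norm_num
  unit := by
    have hr : ‖((√s : ℝ) : ℂ)‖ ^ 2 = s := by
      rw [Complex.norm_real, Real.norm_eq_abs, sq_abs, Real.sq_sqrt hs]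
    intro i
    fin_cases i
    · exact wVector_isUnitVector (by rw [hr, h])
    · exact wVector_isUnitVector (by rw [norm_neg, hr, h])
  decomp := by
    have := pureDensity_add_smul_add_sub (wVector a 0 b) (ket (0, 0)) (√s)
    rw [Real.sq_sqrt hs, ← wVector_eq_add, ← wVector_eq_add] at this
    rw [wMixture, ← this, Fin.sum_univ_two]
    simp

theorem wMixtureDecomposition_average {a : ℂ} {b : κ → ℂ} {s : ℝ} (hs : 0 ≤ s)
    (h : ‖a‖ ^ 2 + s + ∑ k, ‖b k‖ ^ 2 = 1) {F : (Qubits κ → ℂ) → ℝ} {c : ℝ}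
    (hF : ∀ r, IsUnitVector (wVector a r b) → F (wVector a r b) = c) :
    (wMixtureDecomposition hs h).average F = c := by
  have h0 := hF _ ((wMixtureDecomposition hs h).unit (0 : Fin 2))
  have h1 := hF _ ((wMixtureDecomposition hs h).unit (1 : Fin 2))
  have e : (wMixtureDecomposition hs h).average F =
      2⁻¹ * F (wVector a (√s : ℝ) b) + 2⁻¹ * F (wVector a (-(√s : ℝ)) b) :=
    Fin.sum_univ_two _
  rw [e, h0, h1]
  ring

theorem renyiOfSqConcurrence_nonneg {α x : ℝ} (hα : 1 / 2 ≤ α) (h : α ^ 2 + α ≤ 3)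
    (hx : x ∈ Set.Icc (0 : ℝ) 1) : 0 ≤ renyiOfSqConcurrence α x := by
  rw [← renyiOfSqConcurrence_zero (α := α) (by linarith)]
  exact (renyiOfSqConcurrence_concaveOn_and_monotoneOn hα h).2 ⟨le_rfl, zero_le_one⟩ hx hx.1

/-- Needed for `le_ciSup`: an unbounded real supremum would default to 0. -/
theorem bddAbove_average_renyiEntanglementPure {b : Type*} [Fintype b] {α : ℝ} (hα : 1 / 2 ≤ α)
    (h : α ^ 2 + α ≤ 3) (ρ : Matrix (Fin 2 × b) (Fin 2 × b) ℂ) :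
    BddAbove (Set.range fun D : PureDecomposition ρ => D.average (renyiEntanglementPure α)) := by
  refine ⟨renyiOfSqConcurrence α 1, ?_⟩
  rintro _ ⟨D, rfl⟩
  calc D.average (renyiEntanglementPure α)
      ≤ ∑ i, D.p i * renyiOfSqConcurrence α 1 := by
        refine Finset.sum_le_sum fun i _ => mul_le_mul_of_nonneg_left ?_ (D.p_nonneg i)
        have hm := sqConcurrence_mem_Icc (D.unit i)
        rw [renyiEntanglementPure_eq α (D.unit i)]
        exact (renyiOfSqConcurrence_concaveOn_and_monotoneOn hα h).2 hm ⟨zero_le_one, le_rfl⟩ hm.2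
    _ = renyiOfSqConcurrence α 1 := by rw [← Finset.sum_mul, D.p_sum, one_mul]

theorem le_renyiAssistance_wMixture {α : ℝ} (hα : 1 / 2 ≤ α) (hα' : α ^ 2 + α ≤ 3) {a : ℂ}
    {b : κ → ℂ} {s : ℝ} (hs : 0 ≤ s) (h : ‖a‖ ^ 2 + s + ∑ k, ‖b k‖ ^ 2 = 1) :
    renyiOfSqConcurrence α (4 * (‖a‖ ^ 2 * ∑ k, ‖b k‖ ^ 2)) ≤
      renyiAssistance α (wMixture a b s) := by
  refine le_of_eq_of_le ?_ (le_ciSup (bddAbove_average_renyiEntanglementPure hα hα' _)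
    (wMixtureDecomposition hs h))
  refine (wMixtureDecomposition_average hs h fun r hr => ?_).symm
  rw [renyiEntanglementPure_eq α hr, sqConcurrence_wVector]

theorem sqrt_four_mul_sq_mul (x : ℝ) (y : ℝ) (hx : 0 ≤ x) : √(4 * (x ^ 2 * y)) = 2 * (x * √y) := by
  rw [show 4 * (x ^ 2 * y) = (2 * x) ^ 2 * y by ring, Real.sqrt_mul (sq_nonneg _),
    Real.sqrt_sq (by positivity), mul_assoc]

theorem concurrence_wMixture_le {a : ℂ} {b : κ → ℂ} {s : ℝ} (hs : 0 ≤ s)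
    (h : ‖a‖ ^ 2 + s + ∑ k, ‖b k‖ ^ 2 = 1) :
    concurrence (wMixture a b s) ≤ 2 * (‖a‖ * √(∑ k, ‖b k‖ ^ 2)) := by
  refine (ciInf_le ⟨0, ?_⟩ (wMixtureDecomposition hs h)).trans_eq ?_
  · rintro _ ⟨D, rfl⟩
    exact Finset.sum_nonneg fun i _ => mul_nonneg (D.p_nonneg i) (Real.sqrt_nonneg _)
  · refine wMixtureDecomposition_average hs h fun r hr => ?_
    rw [concurrencePure_eq hr, sqConcurrence_wVector, sqrt_four_mul_sq_mul _ _ (norm_nonneg a)]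

theorem PureDecomposition.apply {d : Type*} [Fintype d] {ρ : Matrix d d ℂ}
    (D : PureDecomposition ρ) (x y : d) :
    ρ x y = ∑ i, (D.p i : ℂ) * (D.ψ i x * star (D.ψ i y)) := by
  conv_lhs => rw [D.decomp]
  simp [Matrix.sum_apply, pureDensity, Matrix.vecMulVec_apply]

theorem PureDecomposition.apply_eq_zero {d : Type*} [Fintype d] {ρ : Matrix d d ℂ}
    (D : PureDecomposition ρ) {x : d} (hx : ρ x x = 0) {i : Fin D.n} (hi : D.p i ≠ 0) :
    D.ψ i x = 0 := by
  have h : ((∑ i, D.p i * ‖D.ψ i x‖ ^ 2 : ℝ) : ℂ) = 0 := by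
    rw [← hx, D.apply]
    simp [Complex.mul_conj']
  have h' := Complex.ofReal_eq_zero.1 h
  rw [Finset.sum_eq_zero_iff_of_nonneg
    (fun j _ => mul_nonneg (D.p_nonneg j) (sq_nonneg _))] at h'
  simpa [hi] using h' i (Finset.mem_univ i)

theorem norm_sum_star_mul_le {ι : Type*} (s : Finset ι) (u v : ι → ℂ) :
    ‖∑ i ∈ s, star (u i) * v i‖ ≤ √(∑ i ∈ s, ‖u i‖ ^ 2) * √(∑ i ∈ s, ‖v i‖ ^ 2) := by
  refine (norm_sum_le _ _).trans ?_
  simp only [norm_mul, norm_star]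
  exact Real.sum_mul_le_sqrt_mul_sqrt s _ _

/-- The vanishing diagonal forces every member with positive weight to have only (1, 0) in its row A
= 1, so its concurrence is 2|ψ(1,0)| times the norm of (ψ(0,e))_{e≠0}. Cauchy–Schwarz against the
excitation vector bounds its contribution to the coherences between (0,e) and (1,0), and these are
fixed by the mixture. -/
theorem le_concurrence_wMixture {a : ℂ} {b : κ → ℂ} {s : ℝ} (hs : 0 ≤ s)
    (h : ‖a‖ ^ 2 + s + ∑ k, ‖b k‖ ^ 2 = 1) :
    2 * (‖a‖ * √(∑ k, ‖b k‖ ^ 2)) ≤ concurrence (wMixture a b s) := by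
  have : Nonempty (PureDecomposition (wMixture a b s)) := ⟨wMixtureDecomposition hs h⟩
  refine le_ciInf fun D => ?_
  set B := ∑ k, ‖b k‖ ^ 2 with hB
  have hB0 : 0 ≤ B := Finset.sum_nonneg fun k _ => sq_nonneg _
  -- The case B = 0 is separate because √B is cancelled at the end.
  rcases hB0.eq_or_lt with h0 | hBpos
  · rw [← h0, Real.sqrt_zero, mul_zero, mul_zero]
    exact Finset.sum_nonneg fun i _ => mul_nonneg (D.p_nonneg i) (Real.sqrt_nonneg _)
  have hdiag : ∀ e : κ → Fin 2, e ≠ 0 → wMixture a b s (1, e) (1, e) = 0 := by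
    intro e he
    simp [wMixture, pureDensity, Matrix.vecMulVec_apply, wVector, ket, he]
  have hoff : ∀ e : κ → Fin 2, wMixture a b s (0, e) (1, 0) = excitation b e * star a := by
    intro e
    simp [wMixture, pureDensity, Matrix.vecMulVec_apply, wVector, ket]
  have hterm : ∀ i, 2 * ‖(D.p i : ℂ) * ∑ e, star (excitation b e) *
      (D.ψ i (0, e) * star (D.ψ i (1, 0)))‖ ≤ √B * (D.p i * concurrencePure (D.ψ i)) := by
    intro i
    rcases eq_or_ne (D.p i) 0 with hi | hi
    · simp [hi]
    have hsupp : ∀ e, e ≠ 0 → D.ψ i (1, e) = 0 := fun e he => D.apply_eq_zero (hdiag e he) hi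
    have hCS := norm_sum_star_mul_le (Finset.univ.erase 0) (excitation b) fun e => D.ψ i (0, e)
    have hB' : ∑ e ∈ Finset.univ.erase 0, ‖excitation b e‖ ^ 2 = B := by
      rw [hB, ← sum_sq_norm_excitation, ← Finset.add_sum_erase _ _ (Finset.mem_univ 0),
        excitation_zero]
      simp
    have hsum : ∑ e, star (excitation b e) * (D.ψ i (0, e) * star (D.ψ i (1, 0))) =
        (∑ e ∈ Finset.univ.erase 0, star (excitation b e) * D.ψ i (0, e)) *
          star (D.ψ i (1, 0)) := by
      rw [← Finset.add_sum_erase _ _ (Finset.mem_univ 0), excitation_zero, Finset.sum_mul]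
      simp [mul_assoc]
    rw [hB'] at hCS
    rw [concurrencePure_eq (D.unit i), sqConcurrence_of_support 0 hsupp,
      sqrt_four_mul_sq_mul _ _ (norm_nonneg _), hsum, norm_mul, norm_mul, norm_star,
      Complex.norm_real, Real.norm_of_nonneg (D.p_nonneg i)]
    have := mul_le_mul_of_nonneg_left hCS (mul_nonneg (D.p_nonneg i) (norm_nonneg (D.ψ i (1, 0))))
    linarith
  have htotal : ∑ i, (D.p i : ℂ) * ∑ e, star (excitation b e) *
      (D.ψ i (0, e) * star (D.ψ i (1, 0))) = (B : ℂ) * star a := by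
    have h1 : ∀ e : κ → Fin 2, star (excitation b e) * wMixture a b s (0, e) (1, 0) =
        ((‖excitation b e‖ ^ 2 : ℝ) : ℂ) * star a := by
      intro e
      rw [hoff, Complex.ofReal_pow, ← Complex.conj_mul', Complex.star_def, mul_assoc]
    have h2 : ∑ e, star (excitation b e) * wMixture a b s (0, e) (1, 0) = (B : ℂ) * star a := by
      rw [Finset.sum_congr rfl fun e _ => h1 e, ← Finset.sum_mul, ← Complex.ofReal_sum,
        sum_sq_norm_excitation]
    rw [← h2]
    simp only [D.apply, Finset.mul_sum]
    rw [Finset.sum_comm]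
    refine Finset.sum_congr rfl fun e _ => Finset.sum_congr rfl fun i _ => ?_
    ring
  have hle : 2 * ‖(B : ℂ) * star a‖ ≤ √B * D.average concurrencePure := by
    rw [← htotal, PureDecomposition.average, Finset.mul_sum]
    refine (mul_le_mul_of_nonneg_left (norm_sum_le _ _) zero_le_two).trans ?_
    rw [Finset.mul_sum]
    exact Finset.sum_le_sum fun i _ => hterm i
  rw [norm_mul, norm_star, Complex.norm_real, Real.norm_of_nonneg hB0] at hle
  have hsB : 0 < √B := Real.sqrt_pos.2 hBpos
  have hBB : B = √B * √B := (Real.mul_self_sqrt hB0).symm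
  refine le_of_mul_le_mul_left ?_ hsB
  calc √B * (2 * (‖a‖ * √B)) = 2 * ((√B * √B) * ‖a‖) := by ring
    _ = 2 * (B * ‖a‖) := by rw [← hBB]
    _ ≤ _ := hle

theorem renyiAssistance_pureDensity_le {b : Type*} [Fintype b] {α : ℝ} (hα : 1 / 2 ≤ α)
    (h : α ^ 2 + α ≤ 3) {ψ : Fin 2 × b → ℂ} (hψ : IsUnitVector ψ) :
    renyiAssistance α (pureDensity ψ) ≤ renyiOfSqConcurrence α (sqConcurrence ψ) := by
  refine Real.iSup_le (fun D => ?_) (renyiOfSqConcurrence_nonneg hα h (sqConcurrence_mem_Icc hψ))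
  refine le_of_eq ?_
  calc D.average (renyiEntanglementPure α)
      = ∑ i, D.p i * renyiOfSqConcurrence α (sqConcurrence ψ) := by
        refine Finset.sum_congr rfl fun i _ => ?_
        rcases eq_or_ne (D.p i) 0 with hi | hi
        · simp [hi]
        · rw [renyiEntanglementPure_eq α (D.unit i), sqConcurrence, sqConcurrence, reducedA,
            D.pureDensity_eq hψ hi, reducedA]
    _ = renyiOfSqConcurrence α (sqConcurrence ψ) := by rw [← Finset.sum_mul, D.p_sum, one_mul]

theorem norm_sq_add_complement_add {a : ℂ} {b : κ → ℂ} (h : ‖a‖ ^ 2 + ∑ k, ‖b k‖ ^ 2 = 1)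
    (S : Finset κ) :
    ‖a‖ ^ 2 + ∑ k : {k // k ∉ S}, ‖b k‖ ^ 2 + ∑ k : {k // k ∈ S}, ‖b k‖ ^ 2 = 1 := by
  rw [← h, ← Fintype.sum_subtype_add_sum_subtype (· ∈ S) fun k => ‖b k‖ ^ 2, add_assoc]
  congr 1
  rw [add_comm]
  congr 1
  exact Finset.sum_congr (by ext; simp) fun _ _ => rfl

theorem concurrence_marginal_wVector {a : ℂ} {b : κ → ℂ} (h : ‖a‖ ^ 2 + ∑ k, ‖b k‖ ^ 2 = 1)
    (S : Finset κ) :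
    concurrence (marginal (pureDensity (wVector a 0 b)) S) =
      2 * (‖a‖ * √(∑ k ∈ S, ‖b k‖ ^ 2)) := by
  have hS := norm_sq_add_complement_add h S
  have h0 : 0 ≤ ∑ k : {k // k ∉ S}, ‖b k‖ ^ 2 := Finset.sum_nonneg fun _ _ => sq_nonneg _
  rw [marginal_wVector, ← Finset.sum_coe_sort S fun k => ‖b k‖ ^ 2]
  exact le_antisymm (concurrence_wMixture_le h0 hS) (le_concurrence_wMixture h0 hS)

theorem le_renyiAssistance_marginal_wVector {α : ℝ} (hα : 1 / 2 ≤ α) (hα' : α ^ 2 + α ≤ 3) {a : ℂ}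
    {b : κ → ℂ} (h : ‖a‖ ^ 2 + ∑ k, ‖b k‖ ^ 2 = 1) (S : Finset κ) :
    renyiOfSqConcurrence α (4 * (‖a‖ ^ 2 * ∑ k ∈ S, ‖b k‖ ^ 2)) ≤
      renyiAssistance α (marginal (pureDensity (wVector a 0 b)) S) := by
  rw [marginal_wVector, ← Finset.sum_coe_sort S fun k => ‖b k‖ ^ 2]
  exact le_renyiAssistance_wMixture hα hα' (Finset.sum_nonneg fun _ _ => sq_nonneg _)
    (norm_sq_add_complement_add h S)

end WMixture

/-! ### The polygamy inequality. -/

theorem renyiAssistance_wState_rpow_le {n : ℕ} {a : ℂ} {b : Fin (n + 1) → ℂ}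
    (hnorm : ‖a‖ ^ 2 + ∑ i, ‖b i‖ ^ 2 = 1)
    (hC : ∀ i : Fin (n + 1), (i : ℕ) + 1 < n + 1 →
      concurrence (marginal (pureDensity (wState a b)) (Finset.Ioi i)) ≤
        concurrence (marginal (pureDensity (wState a b)) {i}))
    {α : ℝ} (hα : 1 / 2 ≤ α) (hα' : α ^ 2 + α ≤ 3) {μ : ℝ} (hμ : μ ∈ Set.Icc (0 : ℝ) 1) :
    renyiAssistance α (pureDensity (wState a b)) ^ μ ≤
      ∑ i : Fin (n + 1), ((2 : ℝ) ^ μ - 1) ^ (i : ℕ) *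
        renyiAssistance α (marginal (pureDensity (wState a b)) {i}) ^ μ := by
  rw [wState_eq_wVector] at *
  obtain ⟨hconc, hmono⟩ := renyiOfSqConcurrence_concaveOn_and_monotoneOn hα hα'
  have hf0 : ∀ x ∈ Set.Icc (0 : ℝ) 1, 0 ≤ renyiOfSqConcurrence α x := fun x hx =>
    renyiOfSqConcurrence_nonneg hα hα' hx
  have hz : 0 ≤ renyiOfSqConcurrence α 0 := hf0 0 ⟨le_rfl, zero_le_one⟩
  set c : Fin (n + 1) → ℝ := fun i => 4 * (‖a‖ ^ 2 * ‖b i‖ ^ 2) with hcdef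
  have hc : ∀ i, 0 ≤ c i := fun i => by positivity
  have hcsum : ∀ S : Finset (Fin (n + 1)), ∑ i ∈ S, c i = 4 * (‖a‖ ^ 2 * ∑ i ∈ S, ‖b i‖ ^ 2) := by
    intro S
    simp only [hcdef, Finset.mul_sum]
  have hs : ∑ i, c i ≤ 1 := by
    rw [hcsum, show ∑ i, ‖b i‖ ^ 2 = 1 - ‖a‖ ^ 2 by linarith]
    -- With p = |a|² the claim is 4p(1-p) ≤ 1.
    nlinarith [sq_nonneg (2 * ‖a‖ ^ 2 - 1)]
  have hord : ∀ i : Fin (n + 1), (i : ℕ) + 1 < n + 1 → ∑ j ∈ Finset.Ioi i, c j ≤ c i := by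
    intro i hi
    have h := hC i hi
    rw [concurrence_marginal_wVector hnorm, concurrence_marginal_wVector hnorm,
      ← sqrt_four_mul_sq_mul _ _ (norm_nonneg a), ← sqrt_four_mul_sq_mul _ _ (norm_nonneg a),
      ← hcsum, ← hcsum, Finset.sum_singleton] at h
    exact (Real.sqrt_le_sqrt_iff (hc i)).1 h
  have hunit : IsUnitVector (wVector a 0 b) := wVector_isUnitVector (by simpa using hnorm)
  have hpure := renyiAssistance_pureDensity_le hα hα' hunit
  rw [sqConcurrence_wVector, ← hcsum] at hpure
  have hmain := rpow_apply_sum_le hμ.1 hμ.2 hf0 hmono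
    (fun x y hx hy hxy => hconc.subadditive_of_zero hz hx hy hxy) n c hc hs hord
  have hpos : 0 ≤ renyiAssistance α (pureDensity (wVector a 0 b)) := by
    refine Real.iSup_nonneg fun D => Finset.sum_nonneg fun i _ => mul_nonneg (D.p_nonneg i) ?_
    rw [renyiEntanglementPure_eq α (D.unit i)]
    exact hf0 _ (sqConcurrence_mem_Icc (D.unit i))
  refine (Real.rpow_le_rpow hpos hpure hμ.1).trans (hmain.trans ?_)
  refine Finset.sum_le_sum fun i _ => mul_le_mul_of_nonneg_left ?_
    (pow_nonneg (sub_nonneg.2 (Real.one_le_rpow one_le_two hμ.1)) _)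
  have hci : c i ≤ 1 := (Finset.single_le_sum (fun j _ => hc j) (Finset.mem_univ i)).trans hs
  refine Real.rpow_le_rpow (hf0 _ ⟨hc i, hci⟩) ?_ hμ.1
  simpa [hcdef] using le_renyiAssistance_marginal_wVector hα hα' hnorm {i}

end QInfo

open QInfo in
/-- The qubits `B_1, …, B_{N-1}` are indexed by `Fin (N - 1)`, from `0`. -/
theorem theorem4 (N : ℕ) (hN : 2 ≤ N) (a : ℂ) (b : Fin (N - 1) → ℂ)
    (hnorm : ‖a‖ ^ 2 + ∑ i, ‖b i‖ ^ 2 = 1)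
    (ρ : Matrix (Qubits (Fin (N - 1))) (Qubits (Fin (N - 1))) ℂ)
    (hρ : ρ = pureDensity (wState a b))
    (hC : ∀ i : Fin (N - 1), (i : ℕ) + 1 < N - 1 →
      concurrence (marginal ρ (Finset.Ioi i)) ≤ concurrence (marginal ρ {i}))
    (α : ℝ) (hα : α ∈ Set.Icc ((√7 - 1) / 2) ((√13 - 1) / 2))
    (μ : ℝ) (hμ : μ ∈ Set.Icc (0 : ℝ) 1) :
    renyiAssistance α ρ ^ μ ≤
      ∑ i : Fin (N - 1),
        ((2 : ℝ) ^ μ - 1) ^ (i : ℕ) * renyiAssistance α (marginal ρ {i}) ^ μ := by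
  subst hρ
  have hα1 : 1 / 2 ≤ α := by
    have : (2 : ℝ) ≤ √7 := Real.le_sqrt_of_sq_le (by norm_num)
    linarith [hα.1]
  have hα2 : α ^ 2 + α ≤ 3 := by
    have h1 : √13 ^ 2 = 13 := Real.sq_sqrt (by norm_num)
    have h2 : 0 ≤ √13 := Real.sqrt_nonneg _
    nlinarith [hα.2]
  -- Now `N - 1` reduces definitionally to `n + 1`, so no casts between `Fin` types arise.
  obtain ⟨n, rfl⟩ : ∃ n, N = n + 2 := ⟨N - 2, by omega⟩
  exact renyiAssistance_wState_rpow_le hnorm hC hα1 hα2 hμ
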